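/- Let $n\ge 1$ and $d\ge 1$ be integers. For general forms $f_1,\dots,f_{n+1}$ of degree $d$ in $\mathbb C[x_1,\dots,x_n]$ (that is, for all $(n+1)$-tuples of forms of degree $d$ in some nonempty Zariski-open subset of the affine space of such tuples, depending only on $n$ and $d$), the following hold. (1) There is, up to a scalar factor, exactly one relation of degree $d^{n-1}$ among $f_1,\dots,f_{n+1}$: the vector space of homogeneous polynomials $F\in\mathbb C[y_1,\dots,y_{n+1}]$ of degree $d^{n-1}$ (together with $0$) such that $F(f_1,\dots,f_{n+1})=0$ has dimension $1$. (2) The forms $f_1,\dots,f_{n+1}$ have no common zero in $\mathbb P^{n-1}$, and the image of the induced map $\mathbb P^{n-1}\to\mathbb P^{n}$, $[v]\mapsto[f_1(v):\dots:f_{n+1}(v)]$, is an irreducible hypersurface of degree $d^{n-1}$, that is, the zero set of an irreducible form of degree $d^{n-1}$. -/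

import Mathlib

open scoped LinearAlgebra.Projectivization

noncomputable section

/-- A property of `r`-tuples of forms of degree `d` in `ℂ[x₁, …, xₙ]` holds for *general* forms if
it holds for all tuples in some nonempty Zariski-open subset of the affine space of such tuples,
whose coordinates are the coefficients of the forms. As the basic open sets form a basis and this
space is irreducible over an infinite field, this says that the property holds wherever some
nonzero polynomial `P` in the coefficients does not vanish. -/
def HoldsForGeneralForms (n d r : ℕ) (Q : (Fin r → MvPolynomial (Fin n) ℂ) → Prop) : Prop :=
  ∃ P : MvPolynomial (Fin r × {m : Fin n →₀ ℕ // m.degree = d}) ℂ, P ≠ 0 ∧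
    ∀ f : Fin r → MvPolynomial (Fin n) ℂ, (∀ i, (f i).IsHomogeneous d) →
      MvPolynomial.eval (fun p => (f p.1).coeff p.2.1) P ≠ 0 → Q f

/-- The space of algebraic relations of degree `e` among `f₁, …, fᵣ`: the homogeneous polynomials
`F` of degree `e` in `r` variables (zero included) with `F(f₁, …, fᵣ) = 0`. -/
def relationsOfDegree {n r : ℕ} (f : Fin r → MvPolynomial (Fin n) ℂ) (e : ℕ) :
    Submodule ℂ (MvPolynomial (Fin r) ℂ) :=
  MvPolynomial.homogeneousSubmodule (Fin r) ℂ e ⊓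
    LinearMap.ker (MvPolynomial.aeval f : MvPolynomial (Fin r) ℂ →ₐ[ℂ] _).toLinearMap

/-- The polynomials have no common zero in projective space. -/
def NoCommonZero {n r : ℕ} (f : Fin r → MvPolynomial (Fin n) ℂ) : Prop :=
  ∀ v : Fin n → ℂ, v ≠ 0 → (fun i => MvPolynomial.eval v (f i)) ≠ 0

/-- A form of degree `d` satisfies `F(t v) = t ^ d F(v)`. -/
theorem eval_smul_of_isHomogeneous {n d : ℕ} {F : MvPolynomial (Fin n) ℂ}
    (hF : F.IsHomogeneous d) (t : ℂ) (v : Fin n → ℂ) :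
    MvPolynomial.eval (t • v) F = t ^ d * MvPolynomial.eval v F := by
  rw [MvPolynomial.eval_eq, MvPolynomial.eval_eq, Finset.mul_sum]
  refine Finset.sum_congr rfl fun m hm => ?_
  have h : m.degree = d := by
    rw [Finsupp.degree_eq_weight_one]
    exact hF (MvPolynomial.mem_support_iff.mp hm)
  simp only [Pi.smul_apply, smul_eq_mul, mul_pow, Finset.prod_mul_distrib,
    Finset.prod_pow_eq_pow_sum]
  rw [← h, Finsupp.degree_apply]
  ring

/-- The map `ℙⁿ⁻¹ → ℙʳ⁻¹`, `[v] ↦ [f₁(v) : … : fᵣ(v)]`, induced by forms `f₁, …, fᵣ` of the same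
degree without common zero. -/
def inducedMap {n d r : ℕ} (f : Fin r → MvPolynomial (Fin n) ℂ)
    (hf : ∀ i, (f i).IsHomogeneous d) (h0 : NoCommonZero f) :
    ℙ ℂ (Fin n → ℂ) → ℙ ℂ (Fin r → ℂ) :=
  Projectivization.lift
    (fun v => Projectivization.mk ℂ (fun i => MvPolynomial.eval v.1 (f i)) (h0 v.1 v.2))
    (by
      intro a b t hab
      rw [Projectivization.mk_eq_mk_iff']
      refine ⟨t ^ d, funext fun i => ?_⟩
      rw [hab, eval_smul_of_isHomogeneous (hf i)]
      rfl)

/-- The subset `X` of `ℙʳ⁻¹` is an irreducible hypersurface of degree `e`: the zero set of an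
irreducible form of degree `e`. (For a form, vanishing at a point of projective space does not
depend on the representative.) -/
def IsIrreducibleHypersurface {r : ℕ} (X : Set (ℙ ℂ (Fin r → ℂ))) (e : ℕ) : Prop :=
  ∃ F : MvPolynomial (Fin r) ℂ, Irreducible F ∧ F.IsHomogeneous e ∧
    X = {p | MvPolynomial.eval p.rep F = 0}

end

open MvPolynomial

noncomputable section

/-! Write n = k + 1, N = d^k, and single out f₀ among the k + 2 forms; let A be the subalgebra
generated by the others. Two open conditions suffice, each checked at one explicit tuple.

(a) No nonzero relation of degree N lacks the monomial y₀^N. This holds for `diagonalForms`, where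
f₀ has d^k distinct conjugates over A (`eq_zero_of_aeval_diagonalForms_eq_zero`).

(b) In degrees up to nd + d, reduced monomials and multiples of f₁, …, fₙ span all forms. This holds
for the powers xᵢ^d. It makes ℂ[x] finite over A, so f₁, …, fₙ are algebraically independent.

Under (b), the d^k reduced monomials of degree divisible by d span an A-module stable under f₀. The
characteristic polynomial of this action yields a relation F of degree N containing y₀^N
(`exists_monic_relation`). Subtracting a multiple of F from another relation of degree N removes
y₀^N, so (a) gives uniqueness. By (a) also, no nonzero relation has degree below N, so F is
irreducible; as A is integrally closed, F divides every relation. Finally, lying over and the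
Nullstellensatz show that each zero of F is a value of f. -/

/-! ### Generic forms and open conditions -/

instance fintypeDegreeEq (n d : ℕ) : Fintype {m : Fin n →₀ ℕ // m.degree = d} :=
  (Finsupp.finite_of_degree_eq (σ := Fin n) d).fintype

/-- The form of degree `d` in `n` variables with indeterminate coefficients. -/
def genericForm (n d r : ℕ) (i : Fin r) :
    MvPolynomial (Fin n) (MvPolynomial (Fin r × {m : Fin n →₀ ℕ // m.degree = d}) ℂ) :=
  ∑ m : {m : Fin n →₀ ℕ // m.degree = d}, monomial m.1 (X (i, m))

/-- The coefficients of a tuple of forms, as a point of affine space. -/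
def coeffPoint {n r : ℕ} (d : ℕ) (f : Fin r → MvPolynomial (Fin n) ℂ) :
    Fin r × {m : Fin n →₀ ℕ // m.degree = d} → ℂ :=
  fun p => (f p.1).coeff p.2.1

theorem map_genericForm {n d r : ℕ} {f : Fin r → MvPolynomial (Fin n) ℂ}
    (hf : ∀ i, (f i).IsHomogeneous d) (i : Fin r) :
    MvPolynomial.map (eval (coeffPoint d f)) (genericForm n d r i) = f i := by
  classical
  ext m
  simp only [genericForm, map_sum, map_monomial, eval_X, coeff_sum, coeff_monomial, coeffPoint]
  by_cases h : m.degree = d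
  · rw [Finset.sum_eq_single ⟨m, h⟩]
    · simp
    · rintro ⟨b, hb⟩ - hne
      rw [if_neg]
      rintro rfl
      exact hne rfl
    · simp
  · rw [(hf i).coeff_eq_zero h]
    refine Finset.sum_eq_zero fun b _ => if_neg ?_
    rintro rfl
    exact h b.2

/-- Linear independence of a finite family of polynomials depending polynomially on parameters is
an open condition on the parameters. -/
theorem exists_polynomial_of_linearIndependent_map {ι σ τ : Type*} [Finite ι]
    (W : ι → MvPolynomial τ (MvPolynomial σ ℂ)) (p : σ → ℂ)
    (h : LinearIndependent ℂ fun i => MvPolynomial.map (eval p) (W i)) :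
    ∃ P : MvPolynomial σ ℂ, eval p P ≠ 0 ∧ ∀ q : σ → ℂ, eval q P ≠ 0 →
      LinearIndependent ℂ fun i => MvPolynomial.map (eval q) (W i) := by
  classical
  have := Fintype.ofFinite ι
  let J : Finset (τ →₀ ℕ) := Finset.univ.biUnion fun i => (W i).support
  let A : Matrix ι J (MvPolynomial σ ℂ) := Matrix.of fun i j => coeff j.1 (W i)
  have hJ : ∀ (q : σ → ℂ) (c : ι → ℂ), Matrix.vecMul c (A.map (eval q)) = 0 ↔
      ∑ i, c i • MvPolynomial.map (eval q) (W i) = 0 := by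
    intro q c
    constructor
    · intro h0
      ext j
      by_cases hj : j ∈ J
      · have := congrFun h0 ⟨j, hj⟩
        simpa [Matrix.vecMul, dotProduct, A, coeff_sum, coeff_map] using this
      · rw [coeff_sum, coeff_zero]
        refine Finset.sum_eq_zero fun i _ => ?_
        have : coeff j (W i) = 0 := by
          by_contra hne
          exact hj (Finset.mem_biUnion.2 ⟨i, Finset.mem_univ _, mem_support_iff.2 hne⟩)
        rw [coeff_smul, coeff_map, this, map_zero, smul_zero]
    · intro h0
      ext j
      have := congrArg (coeff j.1) h0
      simpa [Matrix.vecMul, dotProduct, A, coeff_sum, coeff_map] using this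
  have hinj : Function.Injective (Matrix.vecMulLinear (A.map (eval p))) := by
    rw [injective_iff_map_eq_zero]
    intro c hc
    exact funext (Fintype.linearIndependent_iff.1 h c ((hJ p c).1 hc))
  -- A constant right inverse `B` of the coefficient matrix at `p` replaces the choice of a minor:
  -- `det (A * B)` is 1 at `p`, and where it is nonzero the rows of `A` are independent.
  obtain ⟨g, hg⟩ := LinearMap.exists_leftInverse_of_injective _ (LinearMap.ker_eq_bot.2 hinj)
  let B : Matrix J ι ℂ := fun j i => g (Pi.single j 1) i
  have hB : ∀ x, Matrix.vecMul x B = g x := by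
    intro x
    conv_rhs => rw [pi_eq_sum_univ' x, map_sum]
    ext i
    simp [Matrix.vecMul, dotProduct, B, Finset.sum_apply]
  have hAB : (A.map (eval p)) * B = 1 := by
    ext i j
    have h1 := congrFun (LinearMap.congr_fun hg (Pi.single i 1)) j
    rw [LinearMap.comp_apply, ← hB, Matrix.vecMulLinear_apply, Matrix.vecMul_vecMul,
      Matrix.single_one_vecMul] at h1
    simpa [Matrix.one_apply, Pi.single_apply, eq_comm] using h1
  let B' : Matrix J ι (MvPolynomial σ ℂ) := B.map C
  have hdet : ∀ q, eval q (A * B').det = (A.map (eval q) * B).det := by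
    intro q
    rw [RingHom.map_det, RingHom.mapMatrix_apply, Matrix.map_mul, Matrix.map_map]
    congr 2
    ext i j
    simp
  refine ⟨(A * B').det, ?_, fun q hq => ?_⟩
  · rw [hdet, hAB]
    simp
  · rw [hdet] at hq
    refine Fintype.linearIndependent_iff.2 fun c hc => congrFun ?_
    apply Matrix.eq_zero_of_vecMul_eq_zero hq
    rw [← Matrix.vecMul_vecMul, (hJ q c).2 hc, Matrix.zero_vecMul]

/-- The products are the images of the monomials of `I`, so a linear dependence is a relation
supported on `I`; the openness criterion for independence then applies to relations. -/
theorem linearIndependent_prod_pow_iff {n r : ℕ} (f : Fin r → MvPolynomial (Fin n) ℂ)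
    {I : Set (Fin r →₀ ℕ)} (hI : I.Finite) :
    (LinearIndependent ℂ fun m : I => ∏ i, f i ^ m.1 i) ↔
      ∀ G : MvPolynomial (Fin r) ℂ, (∀ m ∈ G.support, m ∈ I) → aeval f G = 0 → G = 0 := by
  classical
  have := hI.fintype
  rw [Fintype.linearIndependent_iff]
  constructor
  · intro h G hG hG0
    have hsum : ∑ m : I, coeff m.1 G • ∏ i, f i ^ m.1 i = 0 := by
      rw [← hG0, aeval_def, eval₂_eq']
      rw [← Finset.sum_subtype hI.toFinset (fun x => hI.mem_toFinset)
        (fun m => coeff m G • ∏ i, f i ^ m i)]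
      symm
      rw [← Finset.sum_subset (fun m hm => hI.mem_toFinset.2 (hG m hm))]
      · simp [smul_eq_C_mul]
      · intro m _ hm
        simp [notMem_support_iff.1 hm]
    ext m
    by_cases hm : m ∈ G.support
    · exact h _ hsum ⟨m, hG m hm⟩
    · simpa using hm
  · intro h c hc i
    have hG : (∑ m : I, monomial m.1 (c m)) = (0 : MvPolynomial (Fin r) ℂ) := by
      apply h
      · intro m hm
        by_contra hmI
        rw [mem_support_iff, coeff_sum] at hm
        refine hm (Finset.sum_eq_zero fun b _ => ?_)
        rw [coeff_monomial, if_neg]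
        rintro rfl
        exact hmI b.2
      · rw [map_sum, ← hc]
        refine Finset.sum_congr rfl fun m _ => ?_
        rw [aeval_monomial, Finsupp.prod_fintype _ _ (by simp), smul_eq_C_mul]
        rfl
    have := congrArg (coeff i.1) hG
    simpa [coeff_sum, coeff_monomial, Subtype.ext_iff.symm] using this

/-- The absence of algebraic relations supported on a given finite set of monomials is an open
condition. -/
theorem exists_polynomial_forall_relation_eq_zero {n r d : ℕ} {I : Set (Fin r →₀ ℕ)}
    (hI : I.Finite) {f₀ : Fin r → MvPolynomial (Fin n) ℂ} (hf₀ : ∀ i, (f₀ i).IsHomogeneous d)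
    (h₀ : ∀ G : MvPolynomial (Fin r) ℂ, (∀ m ∈ G.support, m ∈ I) → aeval f₀ G = 0 → G = 0) :
    ∃ P : MvPolynomial (Fin r × {m : Fin n →₀ ℕ // m.degree = d}) ℂ, P ≠ 0 ∧
      ∀ f : Fin r → MvPolynomial (Fin n) ℂ, (∀ i, (f i).IsHomogeneous d) →
        eval (coeffPoint d f) P ≠ 0 →
        ∀ G : MvPolynomial (Fin r) ℂ, (∀ m ∈ G.support, m ∈ I) → aeval f G = 0 → G = 0 := by
  have := hI.to_subtype
  let W : I → MvPolynomial (Fin n) (MvPolynomial (Fin r × {m : Fin n →₀ ℕ // m.degree = d}) ℂ) :=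
    fun m => ∏ i, genericForm n d r i ^ m.1 i
  have hW : ∀ f : Fin r → MvPolynomial (Fin n) ℂ, (∀ i, (f i).IsHomogeneous d) →
      (fun m => MvPolynomial.map (eval (coeffPoint d f)) (W m)) =
        fun m : I => ∏ i, f i ^ m.1 i := by
    intro f hf
    funext m
    simp only [W, map_prod, map_pow, map_genericForm hf]
  obtain ⟨P, hP, hq⟩ := exists_polynomial_of_linearIndependent_map W (coeffPoint d f₀)
    (by rw [hW f₀ hf₀]; exact (linearIndependent_prod_pow_iff f₀ hI).2 h₀)
  refine ⟨P, ?_, fun f hf hPf => (linearIndependent_prod_pow_iff f hI).1 ?_⟩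
  · rintro rfl
    simp at hP
  · rw [← hW f hf]
    exact hq _ hPf

/-! ### A special tuple without relations of low degree in y₀ -/

/-- Evaluation of a polynomial in `n + 1` variables, seen as a univariate one over the polynomials
in the last `n` variables. -/
theorem eval₂_finSuccEquiv {n : ℕ} {S : Type*} [CommRing S] [Algebra ℂ S] (f : Fin (n + 1) → S)
    (G : MvPolynomial (Fin (n + 1)) ℂ) :
    (finSuccEquiv ℂ n G).eval₂ (aeval fun i : Fin n => f i.succ : _ →ₐ[ℂ] S).toRingHom (f 0) =
      aeval f G := by
  induction G using MvPolynomial.induction_on with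
  | C a => simp [finSuccEquiv_apply]
  | add p q hp hq => simp only [map_add, Polynomial.eval₂_add, hp, hq]
  | mul_X p i hp =>
    rw [map_mul, map_mul, Polynomial.eval₂_mul, hp, aeval_X]
    refine congrArg (aeval f p * ·) ?_
    refine Fin.cases ?_ (fun j => ?_) i
    · simp [finSuccEquiv_X_zero]
    · simp [finSuccEquiv_X_succ]

/-- The forms `∑ᵢ x₀ᵈ⁻¹ xᵢ₊₁, x₀ᵈ, …, xₖᵈ`, whose relations have degree at least `dᵏ` in the first
variable. -/
def diagonalForms (k d : ℕ) : Fin (k + 2) → MvPolynomial (Fin (k + 1)) ℂ :=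
  Fin.cons (∑ i : Fin k, X 0 ^ (d - 1) * X i.succ) fun i => X i ^ d

theorem diagonalForms_isHomogeneous {k d : ℕ} (hd : 1 ≤ d) (i : Fin (k + 2)) :
    (diagonalForms k d i).IsHomogeneous d := by
  refine Fin.cases ?_ (fun j => ?_) i
  · change (∑ i : Fin k, (X 0 ^ (d - 1) * X i.succ : MvPolynomial (Fin (k + 1)) ℂ)).IsHomogeneous d
    refine IsHomogeneous.sum _ _ _ fun j _ => ?_
    have := (isHomogeneous_X_pow (R := ℂ) (0 : Fin (k + 1)) (d - 1)).mul
      (isHomogeneous_X ℂ j.succ)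
    rwa [Nat.sub_add_cancel hd] at this
  · exact isHomogeneous_X_pow j d

/-- Scaling the variables by `d`-th roots of unity fixes every xᵢ^d but moves f₀. A relation, read
as a polynomial in y₀, thus has d^k distinct roots, more than its degree. -/
theorem eq_zero_of_aeval_diagonalForms_eq_zero {k d : ℕ} (hd : 1 ≤ d)
    {G : MvPolynomial (Fin (k + 2)) ℂ} (hG : degreeOf 0 G < d ^ k)
    (h0 : aeval (diagonalForms k d) G = 0) : G = 0 := by
  set f := diagonalForms k d with hf
  set φ : MvPolynomial (Fin (k + 1)) ℂ →ₐ[ℂ] MvPolynomial (Fin (k + 1)) ℂ :=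
    aeval fun i : Fin (k + 1) => f i.succ with hφ
  have hφe : φ = expand d := by
    ext i
    simp [hφ, hf, diagonalForms]
  have hφinj : Function.Injective φ := by
    rw [hφe]
    exact expand_injective hd
  have hprim := Complex.isPrimitiveRoot_exp d (by omega)
  set z := Complex.exp (2 * Real.pi * Complex.I / d)
  -- x₀ stays fixed; the other `k` variables are scaled independently.
  let c : (Fin k → Fin d) → Fin (k + 1) → ℂ := fun ζ => Fin.cons 1 fun i => z ^ (ζ i : ℕ)
  have hc : ∀ ζ i, c ζ i ^ d = 1 := by
    intro ζ i
    refine Fin.cases ?_ (fun j => ?_) i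
    · simp [c]
    · simp only [c, Fin.cons_succ]
      rw [← pow_mul, mul_comm, pow_mul, hprim.pow_eq_one, one_pow]
  let s : (Fin k → Fin d) → MvPolynomial (Fin (k + 1)) ℂ →ₐ[ℂ] MvPolynomial (Fin (k + 1)) ℂ :=
    fun ζ => aeval fun i => C (c ζ i) * X i
  have hsφ : ∀ ζ, (s ζ).comp φ = φ := by
    intro ζ
    ext1 i
    simp only [hφ, hf, diagonalForms, AlgHom.comp_apply, aeval_X, Fin.cons_succ, map_pow, s,
      mul_pow, ← C_pow, hc, C_1, one_mul]
  have hroot : ∀ ζ, ((finSuccEquiv ℂ (k + 1) G).map φ.toRingHom).eval (s ζ (f 0)) = 0 := by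
    intro ζ
    have h1 := congrArg (s ζ) (eval₂_finSuccEquiv f G)
    rw [h0, map_zero] at h1
    rw [Polynomial.eval_map, ← h1]
    have h2 := Polynomial.hom_eval₂ (finSuccEquiv ℂ (k + 1) G) φ.toRingHom (s ζ).toRingHom (f 0)
    refine Eq.trans ?_ h2.symm
    congr 1
    exact congrArg AlgHom.toRingHom (hsφ ζ).symm
  have hsinj : Function.Injective fun ζ => s ζ (f 0) := by
    intro ζ η h
    funext i
    -- Setting x₀ = xᵢ₊₁ = 1 and all other variables to 0 isolates the root of unity at index `i`.
    have key : ∀ ξ : Fin k → Fin d,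
        eval (Fin.cons 1 (Pi.single i 1) : Fin (k + 1) → ℂ) (s ξ (f 0)) = z ^ (ξ i : ℕ) := by
      intro ξ
      simp [hf, diagonalForms, s, c, Pi.single_apply]
    have h1 := key ζ
    rw [show s ζ (f 0) = s η (f 0) from h, key η] at h1
    exact Fin.ext (hprim.pow_inj (η i).2 (ζ i).2 h1).symm
  have hp : (finSuccEquiv ℂ (k + 1) G).map φ.toRingHom = 0 := by
    refine Polynomial.eq_zero_of_natDegree_lt_card_of_eval_eq_zero _ hsinj hroot ?_
    refine lt_of_le_of_lt Polynomial.natDegree_map_le ?_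
    rw [natDegree_finSuccEquiv]
    simpa using hG
  rw [Polynomial.map_eq_zero_iff (f := φ.toRingHom) hφinj] at hp
  simpa using hp

/-! ### Reduced monomials and finiteness -/

/-- The exponents of monomials not divisible by any `d`-th power of a variable. -/
def reducedExponents (n d : ℕ) : Set (Fin n →₀ ℕ) := {a | ∀ i, a i < d}

/-- In degree `e`, the reduced monomials together with the multiples of the forms `h i` span all
forms. -/
def SpansInDegree {n : ℕ} (d : ℕ) (h : Fin n → MvPolynomial (Fin n) ℂ) (e : ℕ) : Prop :=
  ∀ m : Fin n →₀ ℕ, m.degree = e → monomial m (1 : ℂ) ∈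
    Submodule.span ℂ ((fun a => monomial a (1 : ℂ)) '' {a ∈ reducedExponents n d | a.degree = e} ∪
      {p | ∃ i m', m'.degree + d = e ∧ p = h i * monomial m' 1})

/-- In each nonreduced monomial, replace one factor xᵢ^d by the corresponding form. For the powers
xᵢ^d this returns the monomial basis, so independence of the new family is a nonempty open
condition; by a dimension count, it then spans. -/
theorem exists_polynomial_spansInDegree (n d e : ℕ) :
    ∃ P : MvPolynomial (Fin (n + 1) × {m : Fin n →₀ ℕ // m.degree = d}) ℂ, P ≠ 0 ∧
      ∀ f : Fin (n + 1) → MvPolynomial (Fin n) ℂ, (∀ i, (f i).IsHomogeneous d) →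
        eval (coeffPoint d f) P ≠ 0 → SpansInDegree d (fun i => f i.succ) e := by
  classical
  let ι := {m : Fin n →₀ ℕ // m.degree = e}
  let σ := Fin (n + 1) × {m : Fin n →₀ ℕ // m.degree = d}
  let V : (Fin (n + 1) → MvPolynomial (Fin n) ℂ) → ι → MvPolynomial (Fin n) ℂ := fun f m =>
    if h : ∃ i, d ≤ m.1 i then
      f h.choose.succ * monomial (m.1 - Finsupp.single h.choose d) 1
    else monomial m.1 1
  let W : ι → MvPolynomial (Fin n) (MvPolynomial σ ℂ) := fun m =>
    if h : ∃ i, d ≤ m.1 i then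
      genericForm n d (n + 1) h.choose.succ * monomial (m.1 - Finsupp.single h.choose d) 1
    else monomial m.1 1
  have hW : ∀ f : Fin (n + 1) → MvPolynomial (Fin n) ℂ, (∀ i, (f i).IsHomogeneous d) →
      (fun m => MvPolynomial.map (eval (coeffPoint d f)) (W m)) = V f := by
    intro f hf
    funext m
    by_cases h : ∃ i, d ≤ m.1 i
    · simp only [W, V, dif_pos h, map_mul, map_genericForm hf, map_monomial, map_one]
    · simp only [W, V, dif_neg h, map_monomial, map_one]
  have hmon : LinearIndependent ℂ fun m : ι => monomial m.1 (1 : ℂ) :=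
    ((basisMonomials (Fin n) ℂ).linearIndependent.comp _ Subtype.val_injective)
  let f₀ : Fin (n + 1) → MvPolynomial (Fin n) ℂ := Fin.cons 0 fun i => X i ^ d
  have hf₀ : ∀ i, (f₀ i).IsHomogeneous d := by
    intro i
    refine Fin.cases (isHomogeneous_zero _ _ _) (fun j => isHomogeneous_X_pow j d) i
  have hV₀ : V f₀ = fun m : ι => monomial m.1 (1 : ℂ) := by
    funext m
    by_cases h : ∃ i, d ≤ m.1 i
    · simp only [V, dif_pos h, f₀, Fin.cons_succ]
      rw [X_pow_eq_monomial, monomial_mul, one_mul, add_tsub_cancel_of_le]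
      simpa using h.choose_spec
    · simp only [V, dif_neg h]
  obtain ⟨P, hP, hq⟩ := exists_polynomial_of_linearIndependent_map W (coeffPoint d f₀)
    (by rw [hW f₀ hf₀, hV₀]; exact hmon)
  refine ⟨P, ?_, fun f hf hPf => ?_⟩
  · rintro rfl
    simp at hP
  have hli := hq _ hPf
  rw [hW f hf] at hli
  have hdeg : ∀ (m : ι) (i : Fin n), d ≤ m.1 i → (m.1 - Finsupp.single i d).degree + d = e := by
    intro m i hi
    have h1 : m.1 - Finsupp.single i d + Finsupp.single i d = m.1 :=
      tsub_add_cancel_of_le (by simpa using hi)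
    have h2 := congrArg Finsupp.degree h1
    rw [map_add, Finsupp.degree_single, m.2] at h2
    exact h2
  have hVhom : ∀ m : ι, (V f m).IsHomogeneous e := by
    intro m
    by_cases h : ∃ i, d ≤ m.1 i
    · simp only [V, dif_pos h]
      have := (hf h.choose.succ).mul (isHomogeneous_monomial (1 : ℂ)
        (rfl : (m.1 - Finsupp.single h.choose d).degree = _))
      rwa [add_comm, hdeg m _ h.choose_spec] at this
    · simp only [V, dif_neg h]
      exact isHomogeneous_monomial _ m.2
  have hle : Submodule.span ℂ (Set.range (V f)) ≤
      Submodule.span ℂ (Set.range fun m : ι => monomial m.1 (1 : ℂ)) := by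
    rw [Submodule.span_le]
    rintro _ ⟨m, rfl⟩
    rw [SetLike.mem_coe, as_sum (V f m)]
    refine Submodule.sum_mem _ fun a ha => ?_
    have ha' : a.degree = e := by
      by_contra hne
      exact mem_support_iff.1 ha ((hVhom m).coeff_eq_zero hne)
    rw [← mul_one (coeff a (V f m)), ← smul_eq_mul, ← smul_monomial]
    exact Submodule.smul_mem _ _ (Submodule.subset_span ⟨⟨a, ha'⟩, rfl⟩)
  have : FiniteDimensional ℂ (Submodule.span ℂ (Set.range fun m : ι => monomial m.1 (1 : ℂ))) :=
    FiniteDimensional.span_of_finite ℂ (Set.finite_range _)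
  have heq := Submodule.eq_of_le_of_finrank_eq hle
    ((finrank_span_eq_card hli).trans (finrank_span_eq_card hmon).symm)
  intro m hm
  have hmem : monomial m (1 : ℂ) ∈ Submodule.span ℂ (Set.range (V f)) := by
    rw [heq]
    exact Submodule.subset_span ⟨⟨m, hm⟩, rfl⟩
  refine Submodule.span_mono ?_ hmem
  rintro _ ⟨a, rfl⟩
  by_cases h : ∃ i, d ≤ a.1 i
  · right
    exact ⟨h.choose, _, hdeg a _ h.choose_spec, by simp only [V, dif_pos h]⟩
  · left
    refine ⟨a.1, ⟨fun i => ?_, a.2⟩, by simp only [V, dif_neg h]⟩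
    by_contra hi
    exact h ⟨i, not_lt.1 hi⟩

theorem degree_le_of_mem_reducedExponents {n d : ℕ} {a : Fin n →₀ ℕ}
    (ha : a ∈ reducedExponents n d) : a.degree ≤ n * d := by
  rw [Finsupp.degree_eq_sum]
  refine (Finset.sum_le_sum fun i _ => (ha i).le).trans ?_
  simp

theorem finite_reducedExponents (n d : ℕ) : (reducedExponents n d).Finite :=
  (Finsupp.finite_of_degree_le (n * d)).subset fun _ => degree_le_of_mem_reducedExponents

/-- Reduced monomials have degree at most nd, so in degree nd + 1 only multiples of the `h i`
remain; every power xⱼ^(nd+1) vanishes at `v`. -/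
theorem eq_zero_of_spansInDegree {n d : ℕ} {h : Fin n → MvPolynomial (Fin n) ℂ}
    (hs : SpansInDegree d h (n * d + 1)) {v : Fin n → ℂ} (hv : ∀ i, eval v (h i) = 0) :
    v = 0 := by
  funext j
  have hmem := hs (Finsupp.single j (n * d + 1)) (Finsupp.degree_single _ _)
  have hle : Submodule.span ℂ ((fun a => monomial a (1 : ℂ)) ''
        {a ∈ reducedExponents n d | a.degree = n * d + 1} ∪
      {p | ∃ i m', m'.degree + d = n * d + 1 ∧ p = h i * monomial m' 1}) ≤
      LinearMap.ker (aeval v : MvPolynomial (Fin n) ℂ →ₐ[ℂ] ℂ).toLinearMap := by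
    rw [Submodule.span_le]
    rintro _ (⟨a, ⟨ha, ha'⟩, rfl⟩ | ⟨i, m', -, rfl⟩)
    · have := degree_le_of_mem_reducedExponents ha
      omega
    · have := hv i
      rw [← coe_aeval_eq_eval] at this
      simp only [SetLike.mem_coe, LinearMap.mem_ker, AlgHom.toLinearMap_apply, map_mul]
      rw [show (aeval v) (h i) = 0 from this, zero_mul]
  have := hle hmem
  rw [LinearMap.mem_ker, AlgHom.toLinearMap_apply, aeval_monomial,
    Finsupp.prod_single_index (h := fun i k => v i ^ k) (pow_zero _), map_one, one_mul] at this
  exact eq_zero_of_pow_eq_zero this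

/-- Modulo the subalgebra generated by the forms `h i`, every monomial of degree at most `D` is a
combination of reduced monomials whose degree is congruent to its own modulo `d`. -/
theorem monomial_mem_span_adjoin {n d D : ℕ} (hd : 1 ≤ d) {h : Fin n → MvPolynomial (Fin n) ℂ}
    (hs : ∀ e ≤ D, SpansInDegree d h e) (m : Fin n →₀ ℕ) (hm : m.degree ≤ D) :
    monomial m (1 : ℂ) ∈ Submodule.span (Algebra.adjoin ℂ (Set.range h))
      ((fun a => monomial a (1 : ℂ)) ''
        {a ∈ reducedExponents n d | a.degree ≡ m.degree [MOD d]}) := by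
  induction he : m.degree using Nat.strong_induction_on generalizing m with
  | _ e ih =>
  have hmem := hs e (he ▸ hm) m he
  have hle : Submodule.span ℂ ((fun a => monomial a (1 : ℂ)) ''
        {a ∈ reducedExponents n d | a.degree = e} ∪
      {p | ∃ i m', m'.degree + d = e ∧ p = h i * monomial m' 1}) ≤
      (Submodule.span (Algebra.adjoin ℂ (Set.range h)) ((fun a => monomial a (1 : ℂ)) ''
        {a ∈ reducedExponents n d | a.degree ≡ e [MOD d]})).restrictScalars ℂ := by
    rw [Submodule.span_le]
    rintro _ (⟨a, ⟨ha, ha'⟩, rfl⟩ | ⟨i, m', hm', rfl⟩)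
    · exact Submodule.subset_span ⟨a, ⟨ha, by rw [ha']⟩, rfl⟩
    · have h1 := ih m'.degree (by omega) m' (by omega) rfl
      have h2 : m'.degree ≡ e [MOD d] := by
        rw [← hm']
        simp [Nat.ModEq]
      have h3 : {a ∈ reducedExponents n d | a.degree ≡ m'.degree [MOD d]} =
          {a ∈ reducedExponents n d | a.degree ≡ e [MOD d]} :=
        Set.ext fun a => and_congr_right fun _ => ⟨fun h => h.trans h2, fun h => h.trans h2.symm⟩
      rw [h3] at h1
      exact Submodule.smul_mem _
        (⟨h i, Algebra.subset_adjoin ⟨i, rfl⟩⟩ : Algebra.adjoin ℂ (Set.range h)) h1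
  exact hle hmem

/-- The span contains 1 and is stable under each variable: a reduced monomial times a variable has
degree at most nd + 1, within the range of the hypothesis. -/
theorem span_adjoin_reducedExponents {n d : ℕ} (hd : 1 ≤ d)
    {h : Fin n → MvPolynomial (Fin n) ℂ} (hs : ∀ e ≤ n * d + d, SpansInDegree d h e) :
    Submodule.span (Algebra.adjoin ℂ (Set.range h))
      ((fun a => monomial a (1 : ℂ)) '' reducedExponents n d) = ⊤ := by
  set M := Submodule.span (Algebra.adjoin ℂ (Set.range h))
      ((fun a => monomial a (1 : ℂ)) '' reducedExponents n d) with hM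
  have hmem : ∀ m : Fin n →₀ ℕ, m.degree ≤ n * d + d → monomial m (1 : ℂ) ∈ M := fun m hm =>
    Submodule.span_mono (Set.image_mono fun _ ha => ha.1) (monomial_mem_span_adjoin hd hs m hm)
  have hX : ∀ (i : Fin n) (p), p ∈ M → p * X i ∈ M := by
    intro i p hp
    induction hp using Submodule.span_induction with
    | mem x hx =>
      obtain ⟨a, ha, rfl⟩ := hx
      dsimp only
      rw [X, monomial_mul, one_mul]
      apply hmem
      rw [map_add, Finsupp.degree_single]
      have := degree_le_of_mem_reducedExponents ha
      omega
    | zero => simp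
    | add x y _ _ hx hy => rw [add_mul]; exact M.add_mem hx hy
    | smul c x _ hx => rw [smul_mul_assoc]; exact M.smul_mem c hx
  rw [eq_top_iff]
  rintro p -
  induction p using MvPolynomial.induction_on with
  | C a =>
    have := (M.restrictScalars ℂ).smul_mem a (hmem 0 (by simp))
    rwa [smul_monomial, smul_eq_mul, mul_one] at this
  | add p q hp hq => exact M.add_mem hp hq
  | mul_X p i hp => exact hX i p hp

theorem finite_adjoin_of_spansInDegree {n d : ℕ} (hd : 1 ≤ d)
    {h : Fin n → MvPolynomial (Fin n) ℂ} (hs : ∀ e ≤ n * d + d, SpansInDegree d h e) :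
    Module.Finite (Algebra.adjoin ℂ (Set.range h)) (MvPolynomial (Fin n) ℂ) :=
  ⟨⟨((finite_reducedExponents n d).image _).toFinset, by
    rw [Set.Finite.coe_toFinset, span_adjoin_reducedExponents hd hs]⟩⟩

/-- ℂ[x] has transcendence degree `n` and is algebraic over the algebra generated by these `n`
elements, which therefore form a transcendence basis. -/
theorem algebraicIndependent_of_finite_adjoin {n : ℕ} {h : Fin n → MvPolynomial (Fin n) ℂ}
    (hfin : Module.Finite (Algebra.adjoin ℂ (Set.range h)) (MvPolynomial (Fin n) ℂ)) :
    AlgebraicIndependent ℂ h := by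
  have : Algebra.IsAlgebraic (Algebra.adjoin ℂ (Set.range h)) (MvPolynomial (Fin n) ℂ) :=
    inferInstance
  refine (Algebra.IsAlgebraic.isTranscendenceBasis_of_lift_le_trdeg_of_finite ℂ h ?_).1
  rw [MvPolynomial.trdeg_of_isDomain]
  simp

/-! ### The relation of degree d^k -/

/-- An element whose multiplication preserves the span of a finite family over a subring satisfies
the characteristic polynomial of the corresponding matrix. -/
theorem eval₂_charpoly_eq_zero {A S ι : Type*} [CommRing A] [CommRing S] [IsDomain S] [Fintype ι]
    [DecidableEq ι] (φ : A →+* S) {e : ι → S} (he : e ≠ 0) (g : S) (M : Matrix ι ι A)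
    (hM : ∀ b, g * e b = ∑ c, φ (M b c) * e c) : M.charpoly.eval₂ φ g = 0 := by
  rw [← Polynomial.eval_map, ← Matrix.charpoly_map, Matrix.eval_charpoly]
  refine Matrix.exists_mulVec_eq_zero_iff.1 ⟨e, he, ?_⟩
  funext b
  rw [Matrix.sub_mulVec, Pi.sub_apply, Pi.zero_apply, sub_eq_zero]
  simp [Matrix.mulVec, dotProduct, Matrix.scalar_apply, Matrix.diagonal_apply, hM b]

/-- The reduced exponents whose degree is divisible by `d`, parametrised by their last `k`
entries. -/
def balancedExponent {k d : ℕ} (b : Fin k → Fin d) : Fin (k + 1) →₀ ℕ :=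
  Finsupp.equivFunOnFinite.symm
    (Fin.cons (((d - 1) * ∑ i, (b i : ℕ)) % d) fun i => (b i : ℕ))

/-- Since d - 1 ≡ -1 modulo `d`, the last `k` entries determine the first. There are thus d^k such
exponents, which fixes the degree of the relation. -/
theorem range_balancedExponent {k d : ℕ} (hd : 1 ≤ d) :
    Set.range (balancedExponent : (Fin k → Fin d) → _) =
      {a ∈ reducedExponents (k + 1) d | a.degree ≡ 0 [MOD d]} := by
  have hmod : ∀ s : ℕ, (d - 1) * s + s ≡ 0 [MOD d] := by
    intro s
    obtain ⟨d, rfl⟩ : ∃ d', d = d' + 1 := ⟨d - 1, by omega⟩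
    rw [Nat.modEq_zero_iff_dvd, Nat.add_sub_cancel, ← Nat.succ_mul]
    exact dvd_mul_right _ _
  ext a
  constructor
  · rintro ⟨b, rfl⟩
    refine ⟨fun i => ?_, ?_⟩
    · refine Fin.cases ?_ (fun j => ?_) i
      · exact Nat.mod_lt _ hd
      · exact (b j).2
    · rw [Finsupp.degree_eq_sum, Fin.sum_univ_succ]
      exact ((Nat.mod_modEq _ _).add_right _).trans (hmod _)
  · rintro ⟨ha, ha'⟩
    refine ⟨fun i => ⟨a i.succ, ha _⟩, ?_⟩
    ext i
    refine Fin.cases ?_ (fun j => rfl) i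
    change ((d - 1) * ∑ i : Fin k, a i.succ) % d = a 0
    rw [Finsupp.degree_eq_sum, Fin.sum_univ_succ] at ha'
    rw [← Nat.mod_eq_of_lt (ha 0)]
    exact Nat.ModEq.add_right_cancel' (∑ i : Fin k, a i.succ) ((hmod _).trans ha'.symm)

/-- Substitution multiplies degrees by d > 0, so distinct degrees cannot cancel; homogeneous
components of relations are relations. -/
theorem homogeneousComponent_aeval {n r d : ℕ} (hd : 1 ≤ d)
    {f : Fin r → MvPolynomial (Fin n) ℂ} (hf : ∀ i, (f i).IsHomogeneous d)
    (G : MvPolynomial (Fin r) ℂ) (j : ℕ) :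
    aeval f (homogeneousComponent j G) = homogeneousComponent (d * j) (aeval f G) := by
  conv_rhs => rw [← sum_homogeneousComponent G, map_sum, map_sum]
  have key : ∀ i, homogeneousComponent (d * j) (aeval f (homogeneousComponent i G)) =
      if i = j then aeval f (homogeneousComponent i G) else 0 := by
    intro i
    have h1 : (aeval f (homogeneousComponent i G)).IsHomogeneous (d * i) :=
      (homogeneousComponent_isHomogeneous i G).aeval f hf
    rw [homogeneousComponent_of_mem h1]
    have : d * j = d * i ↔ i = j := by
      rw [Nat.mul_right_inj (by omega), eq_comm]
    simp only [this]
  simp only [key, Finset.sum_ite_eq', Finset.mem_range]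
  split_ifs with h
  · rfl
  · rw [homogeneousComponent_eq_zero _ _ (by omega), map_zero]

theorem exists_monic_relation {k d : ℕ} (hd : 1 ≤ d)
    {f : Fin (k + 2) → MvPolynomial (Fin (k + 1)) ℂ} (hf : ∀ i, (f i).IsHomogeneous d)
    (hs : ∀ e ≤ (k + 1) * d + d, SpansInDegree d (fun i => f i.succ) e) :
    ∃ F : MvPolynomial (Fin (k + 2)) ℂ, F.IsHomogeneous (d ^ k) ∧
      coeff (Finsupp.single 0 (d ^ k)) F = 1 ∧ aeval f F = 0 := by
  classical
  set h : Fin (k + 1) → MvPolynomial (Fin (k + 1)) ℂ := fun i => f i.succ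
  let φ : MvPolynomial (Fin (k + 1)) ℂ →ₐ[ℂ] MvPolynomial (Fin (k + 1)) ℂ := aeval h
  let e : (Fin k → Fin d) → MvPolynomial (Fin (k + 1)) ℂ :=
    fun b => monomial (balancedExponent b) 1
  have hrange : (fun a => monomial a (1 : ℂ)) '' {a ∈ reducedExponents (k + 1) d |
      a.degree ≡ 0 [MOD d]} = Set.range e := by
    rw [← range_balancedExponent hd, ← Set.range_comp]
    rfl
  have hmem : ∀ b, f 0 * e b ∈
      Submodule.span (Algebra.adjoin ℂ (Set.range h)) (Set.range e) := by
    intro b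
    have hb : balancedExponent b ∈ {a ∈ reducedExponents (k + 1) d | a.degree ≡ 0 [MOD d]} :=
      range_balancedExponent hd ▸ ⟨b, rfl⟩
    rw [as_sum (f 0), Finset.sum_mul]
    refine Submodule.sum_mem _ fun m hm => ?_
    have hmd : m.degree = d := by
      by_contra hne
      exact mem_support_iff.1 hm ((hf 0).coeff_eq_zero hne)
    have hdeg : (m + balancedExponent b).degree ≡ 0 [MOD d] := by
      rw [map_add, hmd]
      simpa [Nat.ModEq] using hb.2
    -- A monomial of f₀ has degree `d` and a reduced one at most nd, whence the bound nd + d; the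
    -- degree modulo `d` is unchanged.
    have := monomial_mem_span_adjoin hd hs (m + balancedExponent b) (by
      have := degree_le_of_mem_reducedExponents hb.1
      rw [map_add, hmd]
      omega)
    have hset : {a ∈ reducedExponents (k + 1) d |
        a.degree ≡ (m + balancedExponent b).degree [MOD d]} =
        {a ∈ reducedExponents (k + 1) d | a.degree ≡ 0 [MOD d]} :=
      Set.ext fun a => and_congr_right fun _ =>
        ⟨fun h => h.trans hdeg, fun h => h.trans hdeg.symm⟩
    rw [hset, hrange] at this
    have h2 := ((Submodule.span (Algebra.adjoin ℂ (Set.range h))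
      (Set.range e)).restrictScalars ℂ).smul_mem (coeff m (f 0)) this
    rwa [smul_monomial, smul_eq_mul, ← monomial_mul] at h2
  have hex : ∀ b, ∃ c : (Fin k → Fin d) → MvPolynomial (Fin (k + 1)) ℂ,
      f 0 * e b = ∑ i, φ (c i) * e i := by
    intro b
    obtain ⟨c, hc⟩ := (Submodule.mem_span_range_iff_exists_fun _).1 (hmem b)
    have hsurj : ∀ i, ∃ p, φ p = (c i : MvPolynomial (Fin (k + 1)) ℂ) := by
      intro i
      exact (Algebra.adjoin_range_eq_range_aeval ℂ h).le (c i).2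
    choose p hp using hsurj
    exact ⟨p, by simp only [hp]; exact hc.symm⟩
  choose M hM using hex
  have hne : e ≠ 0 := by
    intro h0
    have := congrFun h0 fun _ => ⟨0, hd⟩
    simp [e] at this
  have hchar := eval₂_charpoly_eq_zero φ.toRingHom hne (f 0) (Matrix.of M) hM
  set G := (finSuccEquiv ℂ (k + 1)).symm (Matrix.of M).charpoly with hG
  have hG0 : aeval f G = 0 := by
    rw [← eval₂_finSuccEquiv, hG, AlgEquiv.apply_symm_apply]
    exact hchar
  -- The leading term y₀^(d^k) of the characteristic polynomial survives in this component.
  refine ⟨homogeneousComponent (d ^ k) G, homogeneousComponent_isHomogeneous _ _, ?_, ?_⟩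
  · rw [coeff_homogeneousComponent, if_pos (Finsupp.degree_single _ _)]
    have h1 : Finsupp.single (0 : Fin (k + 2)) (d ^ k) =
        Finsupp.cons (d ^ k) (0 : Fin (k + 1) →₀ ℕ) := by
      ext i
      refine Fin.cases ?_ (fun j => ?_) i
      · simp
      · simp
    rw [h1, ← finSuccEquiv_coeff_coeff, hG, AlgEquiv.apply_symm_apply]
    have h2 := (Matrix.charpoly_monic (Matrix.of M)).coeff_natDegree
    rw [Matrix.charpoly_natDegree_eq_dim] at h2
    rw [show d ^ k = Fintype.card (Fin k → Fin d) by simp, h2]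
    simp
  · rw [homogeneousComponent_aeval hd hf, hG0, map_zero]

/-! ### Integrality: divisibility and lifting of points -/

theorem isIntegral_aeval_of_finite_adjoin {n r : ℕ} {h : Fin r → MvPolynomial (Fin n) ℂ}
    (hfin : Module.Finite (Algebra.adjoin ℂ (Set.range h)) (MvPolynomial (Fin n) ℂ)) :
    (aeval h : MvPolynomial (Fin r) ℂ →ₐ[ℂ] MvPolynomial (Fin n) ℂ).toRingHom.IsIntegral := by
  let ψ : MvPolynomial (Fin r) ℂ →ₐ[ℂ] Algebra.adjoin ℂ (Set.range h) :=
    (aeval h).codRestrict _ fun p =>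
      (Algebra.adjoin_range_eq_range_aeval ℂ h).ge ⟨p, rfl⟩
  have hψ : Function.Surjective ψ := by
    intro b
    obtain ⟨p, hp⟩ := (Algebra.adjoin_range_eq_range_aeval ℂ h).le b.2
    exact ⟨p, Subtype.ext hp⟩
  have h1 := RingHom.IsIntegral.trans ψ.toRingHom
    (algebraMap (Algebra.adjoin ℂ (Set.range h)) (MvPolynomial (Fin n) ℂ))
    (RingHom.isIntegral_of_surjective _ hψ)
    (algebraMap_isIntegral_iff.2 inferInstance)
  exact h1

theorem isIntegral_aeval_of_tail {n r : ℕ} {f : Fin (r + 1) → MvPolynomial (Fin n) ℂ}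
    (h : (aeval fun i : Fin r => f i.succ :
      MvPolynomial (Fin r) ℂ →ₐ[ℂ] MvPolynomial (Fin n) ℂ).toRingHom.IsIntegral) :
    (aeval f : MvPolynomial (Fin (r + 1)) ℂ →ₐ[ℂ] MvPolynomial (Fin n) ℂ).toRingHom.IsIntegral := by
  refine RingHom.IsIntegral.tower_top
    (rename Fin.succ : MvPolynomial (Fin r) ℂ →ₐ[ℂ] MvPolynomial (Fin (r + 1)) ℂ).toRingHom
    (aeval f : MvPolynomial (Fin (r + 1)) ℂ →ₐ[ℂ] MvPolynomial (Fin n) ℂ).toRingHom ?_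
  have : (aeval f : MvPolynomial (Fin (r + 1)) ℂ →ₐ[ℂ] MvPolynomial (Fin n) ℂ).comp
      (rename Fin.succ) = aeval fun i : Fin r => f i.succ := by
    ext1 i
    simp
  rw [← this] at h
  exact h

/-- Over an integrally closed domain, an irreducible polynomial vanishing at an integral element
divides every polynomial vanishing there. -/
theorem Polynomial.dvd_of_irreducible_of_eval₂_eq_zero {A S : Type*} [CommRing A] [IsDomain A]
    [IsIntegrallyClosed A] [CommRing S] [IsDomain S] {φ : A →+* S} (hφ : Function.Injective φ)
    {g : S} (hg : φ.IsIntegralElem g) {F G : Polynomial A} (hF : Irreducible F)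
    (hF0 : F.eval₂ φ g = 0) (hG0 : G.eval₂ φ g = 0) : F ∣ G := by
  let _ : Algebra A S := φ.toAlgebra
  have : Module.IsTorsionFree A S := by
    have : FaithfulSMul A S := (faithfulSMul_iff_algebraMap_injective A S).2 hφ
    infer_instance
  have hdF : minpoly A g ∣ F := minpoly.isIntegrallyClosed_dvd hg hF0
  have hdG : minpoly A g ∣ G := minpoly.isIntegrallyClosed_dvd hg hG0
  obtain h | h := hF.dvd_iff.1 hdF
  · exact absurd h (minpoly.not_isUnit A g)
  · exact h.dvd.trans hdG

theorem RingHom.IsIntegral.exists_isMaximal_comap_eq {R S : Type*} [CommRing R] [CommRing S]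
    {φ : R →+* S} (hφ : φ.IsIntegral) (P : Ideal R) [P.IsMaximal] (hP : RingHom.ker φ ≤ P) :
    ∃ Q : Ideal S, Q.IsMaximal ∧ Q.comap φ = P := by
  let _ : Algebra R S := φ.toAlgebra
  have : Algebra.IsIntegral R S := ⟨hφ⟩
  exact Ideal.exists_ideal_over_maximal_of_isIntegral P hP

/-- A point at which every relation among the `f i` vanishes is a value of `f`, as soon as the
polynomial ring is integral over the subring they generate. -/
theorem exists_eval_eq_of_isIntegral {n r : ℕ} {f : Fin r → MvPolynomial (Fin n) ℂ}
    (hf : (aeval f : MvPolynomial (Fin r) ℂ →ₐ[ℂ] MvPolynomial (Fin n) ℂ).toRingHom.IsIntegral)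
    {y : Fin r → ℂ} (hy : ∀ G : MvPolynomial (Fin r) ℂ, aeval f G = 0 → eval y G = 0) :
    ∃ v : Fin n → ℂ, ∀ i, eval v (f i) = y i := by
  -- The maximal ideal of `y` contains all relations, so one of ℂ[x] lies over it; by the
  -- Nullstellensatz that ideal is a point.
  obtain ⟨Q, hQ, hQy⟩ : ∃ Q : Ideal (MvPolynomial (Fin n) ℂ), Q.IsMaximal ∧
      Q.comap (aeval f : MvPolynomial (Fin r) ℂ →ₐ[ℂ] _).toRingHom = vanishingIdeal ℂ {y} := by
    have hmax : (vanishingIdeal ℂ {y} : Ideal (MvPolynomial (Fin r) ℂ)).IsMaximal :=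
      (isMaximal_iff_eq_vanishingIdeal_singleton).2 ⟨y, rfl⟩
    refine hf.exists_isMaximal_comap_eq _ fun G hG => ?_
    have hG' := hy G hG
    rw [← coe_aeval_eq_eval] at hG'
    exact (mem_vanishingIdeal_singleton_iff _ _).2 hG'
  obtain ⟨v, rfl⟩ := (isMaximal_iff_eq_vanishingIdeal_singleton).1 hQ
  refine ⟨v, fun i => ?_⟩
  have h1 : (X i - C (y i) : MvPolynomial (Fin r) ℂ) ∈ vanishingIdeal ℂ {y} := by
    rw [mem_vanishingIdeal_singleton_iff]
    simp
  rw [← hQy, Ideal.mem_comap, mem_vanishingIdeal_singleton_iff] at h1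
  simpa [sub_eq_zero] using h1

/-! ### Minimal degree, irreducibility and uniqueness -/

/-- If no relation of degree `N` has degree less than `N` in the first variable, then every nonzero
relation has degree at least `N`. -/
theorem le_totalDegree_of_aeval_eq_zero {n r d N : ℕ} (hd : 1 ≤ d)
    {f : Fin (r + 2) → MvPolynomial (Fin n) ℂ} (hf : ∀ i, (f i).IsHomogeneous d)
    (hN : ∀ G : MvPolynomial (Fin (r + 2)) ℂ, (∀ m ∈ G.support, m.degree = N ∧ m 0 < N) →
      aeval f G = 0 → G = 0)
    {G : MvPolynomial (Fin (r + 2)) ℂ} (hG : G ≠ 0) (hG0 : aeval f G = 0) :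
    N ≤ G.totalDegree := by
  by_contra! hlt
  obtain ⟨a, ha⟩ := support_nonempty.2 hG
  have hat : a.degree < N := (le_totalDegree ha).trans_lt hlt
  have hcomp : homogeneousComponent a.degree G ≠ 0 := by
    intro h0
    have h1 := congrArg (coeff a) h0
    rw [coeff_homogeneousComponent, if_pos rfl, coeff_zero] at h1
    exact mem_support_iff.1 ha h1
  -- Padding to degree `N` with y₁ rather than y₀ keeps the exponent of y₀ below `N`.
  refine mul_ne_zero hcomp (pow_ne_zero (N - a.degree) (X_ne_zero (R := ℂ) (1 : Fin (r + 2)))) ?_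
  apply hN
  · intro m hm
    rw [X_pow_eq_monomial, mem_support_iff, coeff_mul_monomial'] at hm
    split_ifs at hm with hle
    · rw [mul_one, coeff_homogeneousComponent] at hm
      split_ifs at hm with hdeg
      · have h1 := tsub_add_cancel_of_le hle
        have h2 := congrArg Finsupp.degree h1
        rw [map_add, hdeg, Finsupp.degree_single] at h2
        refine ⟨by omega, ?_⟩
        have h3 := DFunLike.congr_fun h1 0
        have h4 := Finsupp.le_degree 0 (m - Finsupp.single 1 (N - a.degree))
        rw [Finsupp.add_apply, Finsupp.single_eq_of_ne (by simp)] at h3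
        omega
      · exact absurd rfl hm
    · exact absurd rfl hm
  · rw [map_mul, homogeneousComponent_aeval hd hf, hG0, map_zero, zero_mul]

/-- ℂ[x] is a domain, so one factor of `F` is itself a relation; it uses up the whole degree and the
cofactor is constant. -/
theorem irreducible_of_forall_le_totalDegree {n r N : ℕ}
    {f : Fin r → MvPolynomial (Fin n) ℂ}
    (hN : ∀ G : MvPolynomial (Fin r) ℂ, G ≠ 0 → aeval f G = 0 → N ≤ G.totalDegree)
    {F : MvPolynomial (Fin r) ℂ} (hF : F ≠ 0) (hFN : F.totalDegree ≤ N)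
    (hF0 : aeval f F = 0) : Irreducible F := by
  have key : ∀ a b : MvPolynomial (Fin r) ℂ, F = a * b → aeval f a = 0 → IsUnit b := by
    intro a b hab ha0
    have hab0 : a * b ≠ 0 := hab ▸ hF
    have ha := left_ne_zero_of_mul hab0
    have hb := right_ne_zero_of_mul hab0
    have h1 := hN a ha ha0
    rw [hab, totalDegree_mul_of_isDomain ha hb] at hFN
    obtain hb' := totalDegree_eq_zero_iff_eq_C.1 (by omega : b.totalDegree = 0)
    rw [hb'] at hb ⊢
    refine IsUnit.map C (isUnit_iff_ne_zero.2 fun h0 => hb ?_)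
    rw [h0, C_0]
  refine ⟨fun hu => ?_, fun a b hab => ?_⟩
  · have := hu.map (aeval f)
    rw [hF0] at this
    exact not_isUnit_zero this
  · have h0 := hF0
    rw [hab, map_mul, mul_eq_zero] at h0
    exact h0.elim (fun h => Or.inr (key a b hab h))
      fun h => Or.inl (key b a (hab.trans (mul_comm a b)) h)

theorem finrank_relationsOfDegree_eq_one {n r N : ℕ} {f : Fin (r + 1) → MvPolynomial (Fin n) ℂ}
    (hN : ∀ G : MvPolynomial (Fin (r + 1)) ℂ, (∀ m ∈ G.support, m.degree = N ∧ m 0 < N) →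
      aeval f G = 0 → G = 0)
    {F : MvPolynomial (Fin (r + 1)) ℂ} (hF : F.IsHomogeneous N)
    (hF1 : coeff (Finsupp.single 0 N) F = 1) (hF0 : aeval f F = 0) :
    Module.finrank ℂ (relationsOfDegree f N) = 1 := by
  have hmem : F ∈ relationsOfDegree f N := ⟨hF, hF0⟩
  refine finrank_eq_one (⟨F, hmem⟩ : relationsOfDegree f N) ?_ ?_
  · intro h0
    have h1 : F = 0 := congrArg Subtype.val h0
    rw [h1, coeff_zero] at hF1
    exact zero_ne_one hF1
  · rintro ⟨G, hG, hG0⟩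
    have hG0' : aeval f G = 0 := hG0
    refine ⟨coeff (Finsupp.single 0 N) G, Subtype.ext ?_⟩
    have key : G - coeff (Finsupp.single 0 N) G • F = 0 := by
      apply hN
      · intro m hm
        have hhom : (G - coeff (Finsupp.single 0 N) G • F).IsHomogeneous N :=
          ((homogeneousSubmodule (Fin (r + 1)) ℂ N).sub_mem hG
            ((homogeneousSubmodule (Fin (r + 1)) ℂ N).smul_mem _ hF))
        have hdeg : m.degree = N := by
          by_contra hne
          exact mem_support_iff.1 hm (hhom.coeff_eq_zero hne)
        refine ⟨hdeg, lt_of_le_of_ne (hdeg ▸ Finsupp.le_degree 0 m) fun h0 => ?_⟩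
        have hm' : m = Finsupp.single 0 N := by
          have h1 : m = Finsupp.single 0 N + (m - Finsupp.single 0 N) :=
            (add_tsub_cancel_of_le (by simp [h0])).symm
          have h2 := congrArg Finsupp.degree h1
          rw [map_add, Finsupp.degree_single, hdeg] at h2
          have h3 := (Finsupp.degree_eq_zero_iff _).1 (by omega : (m - Finsupp.single 0 N).degree = 0)
          rw [h1, h3, add_zero]
        rw [mem_support_iff, hm', coeff_sub, coeff_smul, hF1, smul_eq_mul, mul_one, sub_self] at hm
        exact hm rfl
      · rw [map_sub, map_smul, hG0', hF0, smul_zero, sub_zero]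
    exact (sub_eq_zero.1 key).symm

/-! ### The image in projective space and the conclusion -/

theorem exists_rep_inducedMap_eq_smul {n d r : ℕ} {f : Fin r → MvPolynomial (Fin n) ℂ}
    (hf : ∀ i, (f i).IsHomogeneous d) (h0 : NoCommonZero f) (p : ℙ ℂ (Fin n → ℂ)) :
    ∃ t : ℂ, (inducedMap f hf h0 p).rep = t • fun i => eval p.rep (f i) := by
  have h1 : inducedMap f hf h0 p =
      Projectivization.mk ℂ (fun i => eval p.rep (f i)) (h0 _ p.rep_nonzero) := by
    conv_lhs => rw [← p.mk_rep]
    rfl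
  rw [h1]
  obtain ⟨a, ha⟩ := Projectivization.exists_smul_eq_mk_rep ℂ _ (h0 _ p.rep_nonzero)
  exact ⟨a, ha.symm⟩

/-- The image of the induced map is cut out by a form generating the ideal of relations, when the
polynomial ring is integral over the subring generated by the forms. -/
theorem range_inducedMap_eq {n d r N : ℕ} (hd : 1 ≤ d) {f : Fin r → MvPolynomial (Fin n) ℂ}
    (hf : ∀ i, (f i).IsHomogeneous d) (h0 : NoCommonZero f)
    (hint : (aeval f : MvPolynomial (Fin r) ℂ →ₐ[ℂ] MvPolynomial (Fin n) ℂ).toRingHom.IsIntegral)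
    {F : MvPolynomial (Fin r) ℂ} (hF : F.IsHomogeneous N) (hF0 : aeval f F = 0)
    (hdvd : ∀ G : MvPolynomial (Fin r) ℂ, aeval f G = 0 → F ∣ G) :
    Set.range (inducedMap f hf h0) = {p | eval p.rep F = 0} := by
  ext p
  constructor
  · rintro ⟨q, rfl⟩
    obtain ⟨t, ht⟩ := exists_rep_inducedMap_eq_smul hf h0 q
    rw [Set.mem_ofPred_eq, ht, eval_smul_of_isHomogeneous hF]
    have h1 : eval (fun i => eval q.rep (f i)) F = eval q.rep (aeval f F) := by
      rw [aeval_def, algebraMap_eq, eval₂_eq', eval_eq']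
      simp
    rw [h1, hF0, map_zero, mul_zero]
  · intro hp
    obtain ⟨v, hv⟩ := exists_eval_eq_of_isIntegral hint (y := p.rep) fun G hG => by
      obtain ⟨H, rfl⟩ := hdvd G hG
      rw [map_mul, hp, zero_mul]
    have hv' : (fun i => eval v (f i)) = p.rep := funext hv
    have hv0 : v ≠ 0 := by
      rintro rfl
      apply p.rep_nonzero
      rw [← hv']
      funext i
      have := eval_smul_of_isHomogeneous (hf i) 0 0
      rwa [zero_smul, zero_pow (by omega), zero_mul] at this
    refine ⟨Projectivization.mk ℂ v hv0, ?_⟩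
    conv_rhs => rw [← p.mk_rep]
    change Projectivization.mk ℂ (fun i => eval v (f i)) _ = _
    simp only [hv']

theorem lemma2p1 (n d : ℕ) (hn : 1 ≤ n) (hd : 1 ≤ d) :
    HoldsForGeneralForms n d (n + 1) (fun f =>
      Module.finrank ℂ (relationsOfDegree f (d ^ (n - 1))) = 1 ∧
      ∃ (hf : ∀ i, (f i).IsHomogeneous d) (h0 : NoCommonZero f),
        IsIrreducibleHypersurface (Set.range (inducedMap f hf h0)) (d ^ (n - 1))) := by
  obtain ⟨k, rfl⟩ : ∃ k, n = k + 1 := ⟨n - 1, by omega⟩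
  rw [Nat.add_sub_cancel]
  set N := d ^ k
  have hN1 : 1 ≤ N := Nat.one_le_pow _ _ hd
  have hI : {m : Fin (k + 2) →₀ ℕ | m.degree = N ∧ m 0 < N}.Finite :=
    (Finsupp.finite_of_degree_eq N).subset fun m hm => hm.1
  obtain ⟨P, hP, hPf⟩ := exists_polynomial_forall_relation_eq_zero hI
    (diagonalForms_isHomogeneous (k := k) hd) fun G hG hG0 =>
      eq_zero_of_aeval_diagonalForms_eq_zero hd
        ((degreeOf_lt_iff hN1).2 fun m hm => (hG m hm).2) hG0
  choose Q hQ hQf using exists_polynomial_spansInDegree (k + 1) d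
  refine ⟨P * ∏ e ∈ Finset.range ((k + 1) * d + d + 1), Q e,
    mul_ne_zero hP (Finset.prod_ne_zero_iff.2 fun e _ => hQ e), fun f hf hne => ?_⟩
  change eval (coeffPoint d f) _ ≠ 0 at hne
  rw [map_mul, map_prod, mul_ne_zero_iff, Finset.prod_ne_zero_iff] at hne
  have hrel := hPf f hf hne.1
  have hs : ∀ e ≤ (k + 1) * d + d, SpansInDegree d (fun i => f i.succ) e := fun e he =>
    hQf e f hf (hne.2 e (Finset.mem_range.2 (by omega)))
  obtain ⟨F, hF, hF1, hF0⟩ := exists_monic_relation hd hf hs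
  have hFne : F ≠ 0 := by
    rintro rfl
    rw [coeff_zero] at hF1
    exact zero_ne_one hF1
  have hirr : Irreducible F := irreducible_of_forall_le_totalDegree
    (fun G hG hG0 => le_totalDegree_of_aeval_eq_zero hd hf hrel hG hG0) hFne hF.totalDegree_le hF0
  have hfin := finite_adjoin_of_spansInDegree hd hs
  have hint := isIntegral_aeval_of_finite_adjoin hfin
  have hnz : NoCommonZero f := fun v hv h0 =>
    hv (eq_zero_of_spansInDegree (hs _ (by omega)) fun i => congrFun h0 i.succ)
  refine ⟨finrank_relationsOfDegree_eq_one hrel hF hF1 hF0, hf, hnz, F, hirr, hF, ?_⟩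
  refine range_inducedMap_eq hd hf hnz (isIntegral_aeval_of_tail hint) hF hF0 fun G hG => ?_
  have hdvd := Polynomial.dvd_of_irreducible_of_eval₂_eq_zero
    (φ := (aeval fun i : Fin (k + 1) => f i.succ :
      MvPolynomial (Fin (k + 1)) ℂ →ₐ[ℂ] MvPolynomial (Fin (k + 1)) ℂ).toRingHom)
    (algebraicIndependent_of_finite_adjoin hfin) (hint (f 0))
    ((MulEquiv.irreducible_iff (finSuccEquiv ℂ (k + 1))).2 hirr)
    ((eval₂_finSuccEquiv f F).trans hF0) ((eval₂_finSuccEquiv f G).trans hG)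
  exact (map_dvd_iff (finSuccEquiv ℂ (k + 1))).1 hdvd

end
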